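/- **Theorem (parameterized Set Cover in the streaming model).** The input is a stream of $m$ sets $S_1,\dots,S_m\subseteq[n]$ in arbitrary order, in which every element of $[n]$ belongs to at most $r$ of the sets; $n\ge 1$, $1\le k\le m$, and $n,m,k,r$ are known to the algorithm. A *randomized streaming algorithm* is a randomized finite-state machine that reads the stream, one set at a time, in several passes in the same order. It updates its memory, with fresh random choices, when a set arrives and at the end of each pass, and after the last pass its answer is a function of its memory content. Its *space* is the number of bits of its memory, i.e. $\log_2$ of the number of possible memory contents; everything that is remembered (including random choices, counters and the partial solution) is charged. There are absolute constants $C>0$ and $p\in\mathbb N$, and for every $c\in\mathbb N$ a constant $K>0$ depending only on $c$, such that for all $0<\delta<1$ and all $n,m,k,r$ as above there is a randomized streaming algorithm that makes at most $C/\delta$ passes, uses at most $$K\,\bigl(rk^2n^{\delta}+n\bigr)\,(1+\log n+\log m)^p$$ bits of space (that is, $\tilde O(rk^2n^\delta+n)$ space), and on every such input, with probability at least $1-m^{-c}$, either outputs (the indices of) a set cover consisting of at most $Ck/\delta$ sets, or correctly reports that no set cover with at most $k$ sets exists. -/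

import Mathlib

open scoped ENNReal

/-- The sub-collection `{S i | i ∈ I}` of the set system `S 0, …, S (m-1) ⊆ [n]` is a set cover:
every element of the universe lies in one of its sets. -/
def IsSetCover {n m : ℕ} (S : Fin m → Finset (Fin n)) (I : Finset (Fin m)) : Prop :=
  ∀ x : Fin n, ∃ i ∈ I, x ∈ S i

/-- The multiplicity of an element: the number of sets of the system that contain it. -/
def elementMultiplicity {n m : ℕ} (S : Fin m → Finset (Fin n)) (x : Fin n) : ℕ :=
  (Finset.univ.filter fun i => x ∈ S i).card

/-- Correctness of an answer to the set cover problem parameterized by `k`, where a cover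
may have up to `b` sets. The answer `some I` claims that `I` is a set cover with at most `b` sets;
the answer `none` declares that there is no set cover with at most `k` sets. -/
def IsCorrectAnswer {n m : ℕ} (S : Fin m → Finset (Fin n)) (k : ℕ) (b : ℝ) :
    Option (Finset (Fin m)) → Prop
  | some I => IsSetCover S I ∧ (I.card : ℝ) ≤ b
  | none => ¬ ∃ I : Finset (Fin m), IsSetCover S I ∧ I.card ≤ k

/-- A randomized multi-pass streaming algorithm for streams of `m` subsets of `[n]`.
`State` is the set of all possible contents of the memory. When a set of the stream arrives, and
at the end of each pass, the memory is updated by means of fresh random choices. Nothing is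
remembered outside the memory: neither earlier random choices, nor the position in the stream,
nor the number of the current pass, nor the (partial) solution. -/
structure StreamingAlgorithm (n m : ℕ) where
  State : Type
  [fintypeState : Fintype State]
  /-- number of passes over the stream -/
  passes : ℕ
  /-- the (possibly random) initial content of the memory -/
  init : PMF State
  /-- the update of the memory when a set arrives -/
  step : State → Finset (Fin n) → PMF State
  /-- the update of the memory at the end of a pass -/
  endPass : State → PMF State
  /-- the answer, read off from the memory after the last pass: indices of sets, or `none` -/
  output : State → Option (Finset (Fin m))

namespace StreamingAlgorithm

attribute [instance] StreamingAlgorithm.fintypeState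

variable {n m : ℕ}

/-- The space in bits: the binary logarithm of the number of possible memory contents. -/
noncomputable def space (A : StreamingAlgorithm n m) : ℝ :=
  Real.logb 2 (Fintype.card A.State)

/-- The effect on the distribution of the memory content of one pass over
`S 0, S 1, …, S (m-1)`, in this order. -/
noncomputable def runPass (A : StreamingAlgorithm n m) (S : Fin m → Finset (Fin n))
    (μ : PMF A.State) : PMF A.State :=
  ((List.ofFn S).foldl (fun ν T => ν.bind fun q => A.step q T) μ).bind A.endPass

/-- The distribution of the answer on the stream `S`. -/
noncomputable def outputDist (A : StreamingAlgorithm n m) (S : Fin m → Finset (Fin n)) :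
    PMF (Option (Finset (Fin m))) :=
  ((A.runPass S)^[A.passes] A.init).map A.output

end StreamingAlgorithm

/-! The algorithm is iterated element sampling. Put `q = 2 n^δ`, and let `U` be a set of uncovered
elements. A family of at most `k` sets that misses more than a `1/q` fraction of `U` covers all of
`s` random points of `U` with probability at most `exp (-s/q)`. There are at most `(m+1)^k`
families, so for `s` about `q k log` of the input size any `k` sets covering the sample cover all
but a `1/q` fraction of `U` (`exists_sampler`).

One pass suffices to store which sets contain the sample points, at most `r` indices per point. If
no `k` sets cover the sample, then no `k` sets cover `[n]`, whatever the sample is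
(`not_exists_cover`). Otherwise such sets join the solution. Since only their indices are known, it
takes another pass to delete their elements, and the sample used during that pass is drawn from a
set that is one step out of date. Hence the uncovered set shrinks by the factor `q` once every two
passes (`invariant_restart`), and `2T` passes with `q^T > n` leave nothing uncovered.

Failures occur only when a sample is drawn, so a union bound over the `2T + 1` draws gives the
error. The space is `n` bits for the uncovered set, plus the solution and about `r s` indices. -/

/-- The finite subsets of `α` with at most `b` elements. -/
abbrev SmallFinset (α : Type*) (b : ℕ) : Type _ := {A : Finset α // A.card ≤ b}

namespace SmallFinset

/-- The set `A` if it has at most `b` elements, and the empty set otherwise. -/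
def truncate {α : Type*} (b : ℕ) (A : Finset α) : SmallFinset α b :=
  if h : A.card ≤ b then ⟨A, h⟩ else ⟨∅, by simp⟩

theorem coe_truncate {α : Type*} {b : ℕ} {A : Finset α} (h : A.card ≤ b) :
    (truncate b A : Finset α) = A := by
  simp [truncate, h]

/-- A set is recovered from its list of elements, padded with `none` to length `b`; each of the `b`
entries has `m + 1` values. -/
theorem card_le (m b : ℕ) : Fintype.card (SmallFinset (Fin m) b) ≤ (m + 1) ^ b := by
  have hinj : Function.Injective
      fun (A : SmallFinset (Fin m) b) (i : Fin b) => A.1.toList[i.1]? := by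
    intro A B h
    have hl : A.1.toList = B.1.toList := by
      refine List.ext_getElem? fun i => ?_
      by_cases hi : i < b
      · exact congrFun h ⟨i, hi⟩
      · rw [List.getElem?_eq_none, List.getElem?_eq_none]
        · simpa using B.2.trans (not_lt.1 hi)
        · simpa using A.2.trans (not_lt.1 hi)
    exact Subtype.ext (by rw [← Finset.toList_toFinset A.1, hl, Finset.toList_toFinset])
  simpa using Fintype.card_le_of_injective _ hinj

end SmallFinset

/-! ### Element sampling -/

section Sampling

variable {n m : ℕ}

/-- The elements of `U` that the sets with indices in `I` leave uncovered. -/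
def uncovered (S : Fin m → Finset (Fin n)) (I : Finset (Fin m)) (U : Finset (Fin n)) :
    Finset (Fin n) :=
  U.filter fun x => ∀ i ∈ I, x ∉ S i

/-- A sample `f` represents `U` if at most `k` sets that cover the sample leave at most
a `1 / q` fraction of `U` uncovered. -/
def Represents (S : Fin m → Finset (Fin n)) (k : ℕ) (q : ℝ) (U : Finset (Fin n)) {s : ℕ}
    (f : Fin s → Fin n) : Prop :=
  ∀ I : Finset (Fin m), I.card ≤ k → (∀ j, ∃ i ∈ I, f j ∈ S i) →
    q * (uncovered S I U).card ≤ U.card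

/-- Removing `R` leaves at most a fraction `1 - 1/q ≤ exp (-1/q)` of `U`, and the `s` points are
independent. -/
theorem card_samples_avoiding_le {q : ℝ} (hq : 0 < q) (s : ℕ) {U R : Finset (Fin n)}
    (hRU : R ⊆ U) (hR : (U.card : ℝ) < q * R.card) :
    (((U \ R).card ^ s : ℕ) : ℝ) ≤ U.card ^ s * Real.exp (-s / q) := by
  have h1 : ((U \ R).card : ℝ) ≤ U.card * Real.exp (-1 / q) := by
    have h2 : ((U \ R).card : ℝ) = U.card - R.card := by
      rw [Finset.card_sdiff_of_subset hRU, Nat.cast_sub (Finset.card_le_card hRU)]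
    have h3 : (U.card : ℝ) / q ≤ R.card := by
      rw [div_le_iff₀ hq]; linarith
    have h4 := mul_le_mul_of_nonneg_left (Real.add_one_le_exp (-1 / q))
      (Nat.cast_nonneg (α := ℝ) U.card)
    have h5 : (U.card : ℝ) * (-1 / q + 1) = U.card - U.card / q := by ring
    linarith
  calc (((U \ R).card ^ s : ℕ) : ℝ) = ((U \ R).card : ℝ) ^ s := by push_cast; rfl
    _ ≤ (U.card * Real.exp (-1 / q)) ^ s := by gcongr
    _ = U.card ^ s * Real.exp (-s / q) := by
      rw [mul_pow, ← Real.exp_nat_mul]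
      congr 2
      ring

/-- Union bound over the families `I` that leave too much of `U` uncovered: a sample is bad only if
it avoids the uncovered part of one of them. -/
theorem card_not_represents_le (S : Fin m → Finset (Fin n)) (k s : ℕ) {q : ℝ} (hq : 0 < q)
    (U : Finset (Fin n)) [DecidablePred fun f : Fin s → Fin n => ¬ Represents S k q U f] :
    (((Fintype.piFinset fun _ : Fin s => U).filter fun f => ¬ Represents S k q U f).card : ℝ) ≤
      U.card ^ s * ((m + 1) ^ k * Real.exp (-s / q)) := by
  classical
  let B : Finset (SmallFinset (Fin m) k) :=
    Finset.univ.filter fun I => (U.card : ℝ) < q * (uncovered S I.1 U).card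
  have hsub : ((Fintype.piFinset fun _ : Fin s => U).filter fun f => ¬ Represents S k q U f) ⊆
      B.biUnion fun I => Fintype.piFinset fun _ : Fin s => U \ uncovered S I.1 U := by
    intro f hf
    simp only [Finset.mem_filter, Fintype.mem_piFinset, Represents, not_forall, not_le] at hf
    obtain ⟨hfU, I, hI, hcov, hlt⟩ := hf
    simp only [Finset.mem_biUnion, Fintype.mem_piFinset]
    refine ⟨⟨I, hI⟩, by simp [B, hlt], fun j => ?_⟩
    obtain ⟨i, hi, hj⟩ := hcov j
    simp only [Finset.mem_sdiff, uncovered, Finset.mem_filter, not_and, not_forall, not_not]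
    exact ⟨hfU j, fun _ => ⟨i, hi, hj⟩⟩
  calc _ ≤ ((∑ I ∈ B, (U \ uncovered S I.1 U).card ^ s : ℕ) : ℝ) := by
        refine Nat.cast_le.2 ((Finset.card_le_card hsub).trans
          (Finset.card_biUnion_le.trans (le_of_eq ?_)))
        simp [Fintype.card_piFinset]
    _ = ∑ I ∈ B, (((U \ uncovered S I.1 U).card ^ s : ℕ) : ℝ) := by push_cast; rfl
    _ ≤ ∑ _I ∈ B, (U.card : ℝ) ^ s * Real.exp (-s / q) :=
        Finset.sum_le_sum fun I hI => card_samples_avoiding_le hq s (Finset.filter_subset _ _)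
          (Finset.mem_filter.1 hI).2
    _ = B.card * ((U.card : ℝ) ^ s * Real.exp (-s / q)) := by simp
    _ ≤ (m + 1) ^ k * ((U.card : ℝ) ^ s * Real.exp (-s / q)) := by
        gcongr
        exact_mod_cast (Finset.card_le_univ B).trans (SmallFinset.card_le m k)
    _ = _ := by ring

/-- The distribution is chosen before `S`: the algorithm has to draw the sample without remembering
the set system. -/
theorem exists_sampler (hn : 1 ≤ n) (m k s : ℕ) {q : ℝ} (hq : 0 < q) (U : Finset (Fin n)) :
    ∃ μ : PMF (Fin s → Fin n), ∀ S : Fin m → Finset (Fin n),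
      μ.toOuterMeasure {f | ¬ Represents S k q U f} ≤
        ENNReal.ofReal ((m + 1) ^ k * Real.exp (-s / q)) := by
  classical
  rcases U.eq_empty_or_nonempty with rfl | hU
  -- With nothing left to sample, a fixed element serves as a dummy; every sample represents the
  -- empty set.
  · refine ⟨PMF.pure fun _ => ⟨0, hn⟩, fun S => ?_⟩
    have : {f : Fin s → Fin n | ¬ Represents S k q ∅ f} = ∅ := by
      ext f; simp [Represents, uncovered]
    simp [this]
  · have hne : (Fintype.piFinset fun _ : Fin s => U).Nonempty :=
      Fintype.piFinset_nonempty.2 fun _ => hU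
    refine ⟨PMF.uniformOfFinset _ hne, fun S => ?_⟩
    rw [PMF.toOuterMeasure_uniformOfFinset_apply]
    have hpos : (0 : ℝ) < (U.card : ℝ) ^ s := by
      have := hU.card_pos
      positivity
    have hcard : ((Fintype.piFinset fun _ : Fin s => U).card : ℝ≥0∞) =
        ENNReal.ofReal ((U.card : ℝ) ^ s) := by
      rw [Fintype.card_piFinset]
      simp [ENNReal.ofReal_pow]
    rw [hcard]
    refine ENNReal.div_le_of_le_mul ?_
    rw [← ENNReal.ofReal_mul (by positivity), ← ENNReal.ofReal_natCast]
    refine ENNReal.ofReal_le_ofReal ?_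
    have := card_not_represents_le S k s hq U
    simp only [Set.mem_ofPred_eq]
    convert this using 1
    ring

end Sampling

/-! ### The memory of the algorithm -/

/-- The memory of the element sampling algorithm: the position in the stream, the elements that
are not covered yet, the partial solution, the sets chosen at the end of the previous pass,
the current sample, and for every sample point the indices of the sets seen to contain it. -/
structure SamplingMemory (n m k r s b : ℕ) where
  pos : Fin (m + 1)
  rest : Finset (Fin n)
  sol : SmallFinset (Fin m) b
  cur : SmallFinset (Fin m) k
  sample : Fin s → Fin n
  inc : Fin s → SmallFinset (Fin m) r

namespace SamplingMemory

variable {n m k r s b : ℕ}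

/-- The memory as a tuple. -/
def equivProd (n m k r s b : ℕ) : SamplingMemory n m k r s b ≃
    Fin (m + 1) × Finset (Fin n) × SmallFinset (Fin m) b × SmallFinset (Fin m) k ×
      (Fin s → Fin n) × (Fin s → SmallFinset (Fin m) r) where
  toFun M := (M.pos, M.rest, M.sol, M.cur, M.sample, M.inc)
  invFun t := ⟨t.1, t.2.1, t.2.2.1, t.2.2.2.1, t.2.2.2.2.1, t.2.2.2.2.2⟩
  left_inv _ := rfl
  right_inv _ := rfl

instance : Fintype (SamplingMemory n m k r s b) :=
  Fintype.ofEquiv _ (equivProd n m k r s b).symm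

theorem card_le (n m k r s b : ℕ) : Fintype.card (SamplingMemory n m k r s b) ≤
    2 ^ n * (m + 1) ^ (1 + b + k + r * s) * n ^ s := by
  rw [Fintype.card_congr (equivProd n m k r s b)]
  simp only [Fintype.card_prod, Fintype.card_fin, Fintype.card_finset, Fintype.card_pi,
    Finset.prod_const, Finset.card_univ]
  calc _ ≤ (m + 1) * (2 ^ n * ((m + 1) ^ b * ((m + 1) ^ k * (n ^ s * ((m + 1) ^ r) ^ s)))) := by
        gcongr <;> exact SmallFinset.card_le _ _
    _ = _ := by ring

/-- The update of the memory when the set `T` arrives. -/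
def read (M : SamplingMemory n m k r s b) (T : Finset (Fin n)) : SamplingMemory n m k r s b :=
  if h : M.pos.1 < m then
    { M with
      pos := ⟨M.pos.1 + 1, by omega⟩
      rest := if ⟨M.pos.1, h⟩ ∈ M.cur.1 then M.rest \ T else M.rest
      inc := fun j => if M.sample j ∈ T then
        SmallFinset.truncate r (insert ⟨M.pos.1, h⟩ (M.inc j).1) else M.inc j }
  else M

open Classical in
/-- At most `k` sets that cover the sample, if there are such sets. -/
noncomputable def nextCover (M : SamplingMemory n m k r s b) : Option (SmallFinset (Fin m) k) :=
  if h : ∃ I : SmallFinset (Fin m) k, ∀ j, ∃ i ∈ I.1, i ∈ (M.inc j).1 then some h.choose else none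

/-- The memory at the beginning of the next pass, after `I` is added to the solution and
`f` is drawn as the new sample. -/
def restart (M : SamplingMemory n m k r s b) (I : SmallFinset (Fin m) k) (f : Fin s → Fin n) :
    SamplingMemory n m k r s b where
  pos := 0
  rest := M.rest
  sol := SmallFinset.truncate b (M.sol.1 ∪ I.1)
  cur := I
  sample := f
  inc _ := ⟨∅, by simp⟩

/-- The initial memory with sample `f`. -/
def start (f : Fin s → Fin n) : SamplingMemory n m k r s b where
  pos := 0
  rest := Finset.univ
  sol := ⟨∅, by simp⟩
  cur := ⟨∅, by simp⟩
  sample := f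
  inc _ := ⟨∅, by simp⟩

end SamplingMemory

/-! ### One pass over the stream and the invariant between passes -/

theorem foldl_ofFn_induction {α σ : Type*} {m : ℕ} (S : Fin m → α) (g : σ → α → σ)
    (P : ℕ → σ → Prop) (q : σ) (h0 : P 0 q)
    (hs : ∀ (i : Fin m) (x : σ), P i x → P (i + 1) (g x (S i))) :
    P m ((List.ofFn S).foldl g q) := by
  induction m with
  | zero => simpa using h0
  | succ m ih =>
    rw [List.ofFn_succ', List.concat_eq_append, List.foldl_append]
    exact hs (Fin.last m) _ (ih (fun i => S i.castSucc) fun i x => hs i.castSucc x)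

namespace SamplingMemory

variable {n m k r s b : ℕ}

/-- The memory `M'` after reading the first `t` sets of a pass that began with memory `M`. -/
structure ReadPrefix (S : Fin m → Finset (Fin n)) (M : SamplingMemory n m k r s b) (t : ℕ)
    (M' : SamplingMemory n m k r s b) : Prop where
  pos : M'.pos.1 = t
  rest : M'.rest = uncovered S (M.cur.1.filter fun i => i.1 < t) M.rest
  sol : M'.sol = M.sol
  cur : M'.cur = M.cur
  sample : M'.sample = M.sample
  inc : ∀ j, (M'.inc j).1 = Finset.univ.filter fun i => i.1 < t ∧ M.sample j ∈ S i

theorem ReadPrefix.read {S : Fin m → Finset (Fin n)} (hS : ∀ x, elementMultiplicity S x ≤ r)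
    {M M' : SamplingMemory n m k r s b} {i : Fin m} (h : ReadPrefix S M i M') :
    ReadPrefix S M (i + 1) (M'.read (S i)) := by
  have hlt : M'.pos.1 < m := h.pos ▸ i.2
  have hi : (⟨M'.pos.1, hlt⟩ : Fin m) = i := Fin.ext h.pos
  have hstep : ∀ a : Fin m, a.1 < i.1 + 1 ↔ a.1 < i.1 ∨ a = i := fun a => by
    rw [Fin.ext_iff]; omega
  simp only [SamplingMemory.read, hlt, dite_true, hi]
  refine ⟨by simp [h.pos], ?_, h.sol, h.cur, h.sample, fun j => ?_⟩
  · simp only [h.rest, h.cur]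
    ext x
    split_ifs with hc <;>
      simp only [uncovered, Finset.mem_sdiff, Finset.mem_filter, hstep, and_imp] <;> grind
  · simp only [h.sample]
    have hset : ∀ hx : M.sample j ∈ S i, insert i (M'.inc j).1 =
        Finset.univ.filter fun a : Fin m => a.1 < i.1 + 1 ∧ M.sample j ∈ S a := by
      intro hx
      rw [h.inc]
      ext a
      simp only [Finset.mem_insert, Finset.mem_filter, Finset.mem_univ, true_and, hstep]
      grind
    split_ifs with hx
    -- The multiplicity bound ensures that truncation to `r` indices never loses anything.
    · rw [hset hx, SmallFinset.coe_truncate]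
      refine le_trans (Finset.card_le_card ?_) (hS (M.sample j))
      intro a
      simp only [Finset.mem_filter, Finset.mem_univ, true_and]
      exact And.right
    · rw [h.inc]
      ext a
      simp only [Finset.mem_filter, Finset.mem_univ, true_and, hstep]
      grind

theorem readPrefix_foldl {S : Fin m → Finset (Fin n)} (hS : ∀ x, elementMultiplicity S x ≤ r)
    {M : SamplingMemory n m k r s b} (hpos : M.pos = 0) (hinc : ∀ j, (M.inc j).1 = ∅) :
    ReadPrefix S M m ((List.ofFn S).foldl read M) :=
  foldl_ofFn_induction S read (ReadPrefix S M) M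
    ⟨by simp [hpos], by simp [uncovered], rfl, rfl, rfl, by simp [hinc]⟩
    fun _ _ h => h.read hS

/-- The invariant of the algorithm after `t` passes. The answer `none` has to be justified. -/
inductive Invariant (S : Fin m → Finset (Fin n)) (q : ℝ) (t : ℕ) :
    Option (SamplingMemory n m k r s b) → Prop
  | none (h : ¬ ∃ I : Finset (Fin m), IsSetCover S I ∧ I.card ≤ k) : Invariant S q t none
  | some (M : SamplingMemory n m k r s b) (pos : M.pos = 0) (inc : ∀ j, (M.inc j).1 = ∅)
      -- `sol` already contains `cur`, whose elements leave `rest` only during the coming pass.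
      (cover : ∀ x, x ∉ uncovered S M.cur.1 M.rest → ∃ i ∈ M.sol.1, x ∈ S i)
      (sol : M.sol.1.card ≤ k * t)
      -- Deletion lags by one pass: `next` bounds what `rest` will be after the coming pass. Each of
      -- the two interleaved bounds gains a factor `q` every second pass, hence the halved
      -- exponents.
      (rest : q ^ (t / 2) * M.rest.card ≤ n)
      (next : q ^ ((t + 1) / 2) * (uncovered S M.cur.1 M.rest).card ≤ n)
      (sample : Represents S k q M.rest M.sample) : Invariant S q t (some M)

theorem invariant_start {S : Fin m → Finset (Fin n)} {q : ℝ} {f : Fin s → Fin n}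
    (hf : Represents S k q Finset.univ f) :
    Invariant S q 0 (some (start f : SamplingMemory n m k r s b)) := by
  refine .some _ rfl (fun _ => rfl) ?_ ?_ ?_ ?_ hf <;> simp [start, uncovered]

theorem invariant_restart {S : Fin m → Finset (Fin n)} {q : ℝ} (hq : 0 ≤ q) {t : ℕ}
    (htb : k * (t + 1) ≤ b) {M M' : SamplingMemory n m k r s b} (hM : Invariant S q t (some M))
    (hM' : ReadPrefix S M m M') {I : SmallFinset (Fin m) k} (hI : M'.nextCover = some I)
    {f : Fin s → Fin n} (hf : Represents S k q M'.rest f) :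
    Invariant S q (t + 1) (some (M'.restart I f)) := by
  obtain _ | ⟨_, pos, inc, cover, sol, rest, next, sample⟩ := hM
  have hIcov : ∀ j, ∃ i ∈ I.1, M.sample j ∈ S i := by
    intro j
    rw [nextCover] at hI
    split_ifs at hI with h
    cases hI
    obtain ⟨i, hi, hj⟩ := h.choose_spec j
    rw [hM'.inc] at hj
    exact ⟨i, hi, (Finset.mem_filter.1 hj).2.2⟩
  have hrest : M'.rest = uncovered S M.cur.1 M.rest := by
    rw [hM'.rest, Finset.filter_true_of_mem fun i _ => i.2]
  have hcard : (M'.sol.1 ∪ I.1).card ≤ k * (t + 1) := by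
    refine (Finset.card_union_le _ _).trans ?_
    rw [hM'.sol, mul_add_one]
    exact add_le_add sol I.2
  have hsol : (M'.restart I f).sol.1 = M.sol.1 ∪ I.1 := by
    rw [← hM'.sol]
    exact SmallFinset.coe_truncate (hcard.trans htb)
  refine .some _ rfl (fun _ => rfl) ?_ ?_ ?_ ?_ hf
  · intro x hx
    rw [hsol]
    by_cases hxr : x ∈ M'.rest
    · by_contra! hno
      exact hx (Finset.mem_filter.2 ⟨hxr, fun i hi => hno i (Finset.mem_union_right _ hi)⟩)
    · obtain ⟨i, hi, hxi⟩ := cover x (hrest ▸ hxr)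
      exact ⟨i, Finset.mem_union_left _ hi, hxi⟩
  · rw [hsol, ← hM'.sol]
    exact hcard
  · simpa only [restart, hrest] using next
  · have hle : ((uncovered S I.1 M'.rest).card : ℝ) ≤ (uncovered S I.1 M.rest).card := by
      rw [hrest]
      exact_mod_cast Finset.card_le_card (Finset.filter_subset_filter _ (Finset.filter_subset _ _))
    -- `I` covers the sample of the older set `M.rest`, so the new factor `q` multiplies the bound
    -- for `rest` at time `t`, not the one for `next`.
    have h2 : (t + 1 + 1) / 2 = t / 2 + 1 := by omega
    rw [h2, pow_succ, mul_assoc]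
    refine le_trans ?_ rest
    refine mul_le_mul_of_nonneg_left ?_ (by positivity)
    exact (mul_le_mul_of_nonneg_left hle hq).trans (sample I.1 I.2 hIcov)

/-- A cover of `[n]` covers every sample, so this answer is never wrong, even for an
unrepresentative sample. -/
theorem not_exists_cover {S : Fin m → Finset (Fin n)} {M M' : SamplingMemory n m k r s b}
    (hM' : ReadPrefix S M m M') (hI : M'.nextCover = none) :
    ¬ ∃ I : Finset (Fin m), IsSetCover S I ∧ I.card ≤ k := by
  rintro ⟨I, hI1, hI2⟩
  rw [nextCover] at hI
  split_ifs at hI with h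
  refine h ⟨⟨I, hI2⟩, fun j => ?_⟩
  obtain ⟨i, hi, hx⟩ := hI1 (M.sample j)
  exact ⟨i, hi, by rw [hM'.inc]; simpa using hx⟩

/-- The number of uncovered elements is an integer that is at most `n / q ^ ((t + 1) / 2) < 1`. -/
theorem Invariant.isCorrectAnswer {S : Fin m → Finset (Fin n)} {q : ℝ} {t : ℕ} {β : ℝ}
    (ht : (n : ℝ) < q ^ ((t + 1) / 2)) (hβ : ((k * t : ℕ) : ℝ) ≤ β)
    {x : Option (SamplingMemory n m k r s b)} (hx : Invariant S q t x) :
    IsCorrectAnswer S k β (x.map fun M => M.sol.1) := by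
  obtain h | ⟨M, pos, inc, cover, sol, rest, next, sample⟩ := hx
  · exact h
  · have hempty : uncovered S M.cur.1 M.rest = ∅ := by
      by_contra hne
      have h1 : (1 : ℝ) ≤ (uncovered S M.cur.1 M.rest).card := by
        exact_mod_cast (Finset.nonempty_iff_ne_empty.2 hne).card_pos
      have hq : 0 ≤ q ^ ((t + 1) / 2) := (Nat.cast_nonneg n).trans ht.le
      linarith [mul_le_mul_of_nonneg_left h1 hq]
    refine ⟨fun x => cover x (by simp [hempty]), le_trans ?_ hβ⟩
    exact_mod_cast sol

end SamplingMemory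

/-! ### Error probabilities -/

/-- Union bound for one random transition: either the start is bad, or the transition fails from a
good start. -/
theorem PMF.toOuterMeasure_bind_compl_le {α β : Type*} (μ : PMF α) (κ : α → PMF β)
    {G : Set α} {H : Set β} {a ε : ℝ≥0∞} (hμ : μ.toOuterMeasure Gᶜ ≤ a)
    (hκ : ∀ x ∈ G, (κ x).toOuterMeasure Hᶜ ≤ ε) :
    (μ.bind κ).toOuterMeasure Hᶜ ≤ a + ε := by
  classical
  rw [PMF.toOuterMeasure_bind_apply]
  calc ∑' x, μ x * (κ x).toOuterMeasure Hᶜ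
      ≤ ∑' x, (Set.indicator Gᶜ μ x + μ x * ε) := by
        refine ENNReal.tsum_le_tsum fun x => ?_
        by_cases hx : x ∈ G
        · exact le_add_left (mul_le_mul_right (hκ x hx) _)
        · rw [Set.indicator_of_mem (by exact hx)]
          refine le_add_right (mul_le_of_le_one_right' ?_)
          refine ((κ x).toOuterMeasure.mono (Set.subset_univ _)).trans (le_of_eq ?_)
          exact (PMF.toOuterMeasure_apply_eq_one_iff (κ x) _).2 (Set.subset_univ _)
    _ = μ.toOuterMeasure Gᶜ + ε := by
        rw [ENNReal.tsum_add, ENNReal.tsum_mul_right, μ.tsum_coe, one_mul,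
          PMF.toOuterMeasure_apply]
    _ ≤ a + ε := by gcongr

theorem PMF.toOuterMeasure_pure_compl {α : Type*} {x : α} {H : Set α} (hx : x ∈ H) :
    (PMF.pure x).toOuterMeasure Hᶜ = 0 := by
  classical
  rw [PMF.toOuterMeasure_pure_apply, if_neg (by simpa using hx)]

theorem PMF.toOuterMeasure_bind_pure_compl_le {α β : Type*} (μ : PMF α) (g : α → β)
    {G : Set α} {H : Set β} {a : ℝ≥0∞} (hμ : μ.toOuterMeasure Gᶜ ≤ a) (hg : ∀ x ∈ G, g x ∈ H) :
    (μ.bind fun x => PMF.pure (g x)).toOuterMeasure Hᶜ ≤ a :=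
  (μ.toOuterMeasure_bind_compl_le _ hμ fun x hx =>
    (PMF.toOuterMeasure_pure_compl (hg x hx)).le).trans (add_zero a).le

theorem foldl_bind_pure {α σ : Type*} (g : σ → α → σ) (l : List α) (μ : PMF σ) :
    l.foldl (fun ν T => ν.bind fun q => PMF.pure (g q T)) μ =
      μ.bind fun q => PMF.pure (l.foldl g q) := by
  induction l generalizing μ with
  | nil => simp
  | cons T l ih => simp [ih, PMF.bind_bind]

theorem StreamingAlgorithm.runPass_eq_of_step_eq_pure {n m : ℕ} (A : StreamingAlgorithm n m)
    (g : A.State → Finset (Fin n) → A.State) (hg : A.step = fun q T => PMF.pure (g q T))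
    (S : Fin m → Finset (Fin n)) (μ : PMF A.State) :
    A.runPass S μ = μ.bind fun q => A.endPass ((List.ofFn S).foldl g q) := by
  rw [StreamingAlgorithm.runPass, hg, foldl_bind_pure, PMF.bind_bind]
  simp only [PMF.pure_bind]

theorem foldl_option_map {α σ : Type*} (g : σ → α → σ) (l : List α) (x : Option σ) :
    l.foldl (fun y T => y.map fun M => g M T) x = x.map fun M => l.foldl g M := by
  induction l generalizing x with
  | nil => simp
  | cons T l ih => simp [ih, Function.comp_def]

/-! ### The algorithm -/

open SamplingMemory

/-- The update at the end of a pass: choose a cover of the sample, and draw a new sample by means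
of `ν`. The memory `none` records that there is no cover with at most `k` sets. -/
noncomputable def samplingEndPass {n m k r s b : ℕ} (ν : Finset (Fin n) → PMF (Fin s → Fin n))
    (x : Option (SamplingMemory n m k r s b)) : PMF (Option (SamplingMemory n m k r s b)) :=
  x.elim (PMF.pure none) fun M => M.nextCover.elim (PMF.pure none) fun I =>
    (ν M.rest).bind fun f => PMF.pure (some (M.restart I f))

/-- The element sampling algorithm that makes `P` passes and draws samples by means of `ν`. -/
noncomputable def samplingAlgorithm (n m k r s P : ℕ)
    (ν : Finset (Fin n) → PMF (Fin s → Fin n)) : StreamingAlgorithm n m where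
  State := Option (SamplingMemory n m k r s (k * P))
  passes := P
  init := (ν Finset.univ).bind fun f => PMF.pure (some (start f))
  step x T := PMF.pure (x.map fun M => M.read T)
  endPass := samplingEndPass ν
  output x := x.map fun M => M.sol.1

/-! ### Error probability and space of the algorithm -/

section Analysis

variable {n m k r s P : ℕ} {ν : Finset (Fin n) → PMF (Fin s → Fin n)}

theorem samplingAlgorithm_runPass (S : Fin m → Finset (Fin n))
    (μ : PMF (Option (SamplingMemory n m k r s (k * P)))) :
    (samplingAlgorithm n m k r s P ν).runPass S μ =
      μ.bind fun x => samplingEndPass ν (x.map fun M => (List.ofFn S).foldl read M) := by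
  refine ((samplingAlgorithm n m k r s P ν).runPass_eq_of_step_eq_pure
    (fun (x : Option (SamplingMemory n m k r s (k * P))) T => x.map fun M => M.read T)
    rfl S μ).trans ?_
  exact congrArg (PMF.bind μ) (funext fun x => congrArg _ (foldl_option_map read _ x))

theorem error_endPass {b : ℕ} {S : Fin m → Finset (Fin n)}
    (hS : ∀ x, elementMultiplicity S x ≤ r) {q : ℝ} (hq : 0 ≤ q) {ε : ℝ≥0∞}
    (hν : ∀ U, (ν U).toOuterMeasure {f | ¬ Represents S k q U f} ≤ ε) {t : ℕ}
    (ht : k * (t + 1) ≤ b) {x : Option (SamplingMemory n m k r s b)} (hx : Invariant S q t x) :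
    (samplingEndPass ν (x.map fun M => (List.ofFn S).foldl read M)).toOuterMeasure
      {x | Invariant S q (t + 1) x}ᶜ ≤ ε := by
  rcases x with _ | M
  · obtain ⟨h⟩ := hx
    exact (PMF.toOuterMeasure_pure_compl (Invariant.none h)).trans_le zero_le
  · have hx' := hx
    obtain _ | ⟨_, pos, inc, -⟩ := hx'
    have hR := readPrefix_foldl hS pos inc
    simp only [samplingEndPass, Option.map_some, Option.elim_some]
    set M' := (List.ofFn S).foldl read M
    rcases hI : M'.nextCover with _ | I
    · exact (PMF.toOuterMeasure_pure_compl
        (Invariant.none (not_exists_cover hR hI))).trans_le zero_le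
    · exact PMF.toOuterMeasure_bind_pure_compl_le (ν M'.rest) _ (hν M'.rest)
        (G := {f | Represents S k q M'.rest f}) fun f hf => invariant_restart hq ht hx hR hI hf

theorem error_iterate {S : Fin m → Finset (Fin n)} (hS : ∀ x, elementMultiplicity S x ≤ r)
    {q : ℝ} (hq : 0 ≤ q) {ε : ℝ≥0∞}
    (hν : ∀ U, (ν U).toOuterMeasure {f | ¬ Represents S k q U f} ≤ ε) {t : ℕ} (ht : t ≤ P) :
    PMF.toOuterMeasure (α := Option (SamplingMemory n m k r s (k * P)))
      (((samplingAlgorithm n m k r s P ν).runPass S)^[t]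
        (samplingAlgorithm n m k r s P ν).init) {x | Invariant S q t x}ᶜ ≤ (t + 1) * ε := by
  induction t with
  | zero =>
    rw [Nat.cast_zero, zero_add, one_mul]
    exact PMF.toOuterMeasure_bind_pure_compl_le (ν Finset.univ) _ (hν Finset.univ)
      (G := {f | Represents S k q Finset.univ f}) fun f hf => invariant_start hf
  | succ t ih =>
    rw [Function.iterate_succ_apply']
    refine ((congrArg (fun ρ => PMF.toOuterMeasure ρ _)
      (samplingAlgorithm_runPass S _)).trans_le ?_).trans_eq
      (show (t + 1) * ε + ε = ((t + 1 : ℕ) + 1) * ε by push_cast; ring)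
    exact PMF.toOuterMeasure_bind_compl_le _ _ (ih (by omega)) fun x hx =>
      error_endPass hS hq hν (Nat.mul_le_mul_left k ht) hx

theorem samplingAlgorithm_error {S : Fin m → Finset (Fin n)}
    (hS : ∀ x, elementMultiplicity S x ≤ r) {q : ℝ} (hq : 0 ≤ q) {ε : ℝ≥0∞}
    (hν : ∀ U, (ν U).toOuterMeasure {f | ¬ Represents S k q U f} ≤ ε)
    (hP : (n : ℝ) < q ^ ((P + 1) / 2)) {β : ℝ} (hβ : ((k * P : ℕ) : ℝ) ≤ β) :
    ((samplingAlgorithm n m k r s P ν).outputDist S).toOuterMeasure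
      {o | ¬ IsCorrectAnswer S k β o} ≤ (P + 1) * ε := by
  rw [StreamingAlgorithm.outputDist, PMF.toOuterMeasure_map_apply]
  refine le_trans (MeasureTheory.OuterMeasure.mono _ ?_) (error_iterate hS hq hν le_rfl)
  intro x hx hinv
  exact hx (Invariant.isCorrectAnswer hP hβ hinv)

theorem samplingAlgorithm_space (hn : 1 ≤ n) :
    (samplingAlgorithm n m k r s P ν).space ≤
      1 + n + (1 + k * P + k + r * s) * Real.logb 2 (m + 1) + s * Real.logb 2 n := by
  have hn0 : (n : ℝ) ≠ 0 := by positivity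
  have hcard : Fintype.card (samplingAlgorithm n m k r s P ν).State ≤
      2 * (2 ^ n * (m + 1) ^ (1 + k * P + k + r * s) * n ^ s) := by
    change Fintype.card (Option (SamplingMemory n m k r s (k * P))) ≤ _
    rw [Fintype.card_option]
    have h1 := SamplingMemory.card_le n m k r s (k * P)
    have h2 : 0 < 2 ^ n * (m + 1) ^ (1 + k * P + k + r * s) * n ^ s := by positivity
    omega
  have hpos : 0 < Fintype.card (samplingAlgorithm n m k r s P ν).State :=
    Fintype.card_pos_iff.2 ⟨(none : Option (SamplingMemory n m k r s (k * P)))⟩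
  calc (samplingAlgorithm n m k r s P ν).space
      ≤ Real.logb 2 (2 * (2 ^ n * (m + 1) ^ (1 + k * P + k + r * s) * n ^ s)) :=
        Real.logb_le_logb_of_le one_lt_two (by exact_mod_cast hpos) (by exact_mod_cast hcard)
    _ = _ := by
        rw [Real.logb_mul (by positivity) (by positivity),
          Real.logb_mul (by positivity) (by positivity),
          Real.logb_mul (by positivity) (by positivity), Real.logb_pow, Real.logb_pow,
          Real.logb_pow, Real.logb_self_eq_one one_lt_two]
        push_cast
        ring

end Analysis

/-! ### Choice of the parameters and numerical estimates -/

/-- Both parts of `q = 2 n^δ` are needed: `n^δ` gives `⌈1/δ⌉` rounds, while the factor `2` makes the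
inequality strict and caps the rounds at `log₂ n + 1`. This cap keeps the space constant independent
of `δ`. -/
theorem exists_number_of_rounds {n : ℕ} (hn : 1 ≤ n) {δ : ℝ} (hδ : 0 < δ) (hδ1 : δ < 1) :
    ∃ T : ℕ, (T : ℝ) ≤ 2 / δ ∧ T ≤ Nat.log 2 n + 1 ∧ (n : ℝ) < (2 * (n : ℝ) ^ δ) ^ T := by
  have hn1 : (1 : ℝ) ≤ n := by exact_mod_cast hn
  have hnδ : (1 : ℝ) ≤ (n : ℝ) ^ δ := Real.one_le_rpow hn1 hδ.le
  have hδ' : (⌈1 / δ⌉₊ : ℝ) ≤ 2 / δ := by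
    have h1 := (Nat.ceil_lt_add_one (one_div_nonneg.2 hδ.le)).le
    have h2 : 1 ≤ 1 / δ := (one_le_div hδ).2 hδ1.le
    have h3 : 2 / δ = 1 / δ + 1 / δ := by ring
    linarith
  refine ⟨min (Nat.log 2 n + 1) ⌈1 / δ⌉₊, ?_, min_le_left _ _, ?_⟩
  · exact le_trans (by exact_mod_cast min_le_right _ _) hδ'
  · rcases min_choice (Nat.log 2 n + 1) ⌈1 / δ⌉₊ with h | h <;> rw [h]
    · calc (n : ℝ) < 2 ^ (Nat.log 2 n + 1) := by
            exact_mod_cast Nat.lt_pow_succ_log_self one_lt_two n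
        _ ≤ _ := by gcongr; linarith
    · have h1 : (n : ℝ) ≤ ((n : ℝ) ^ δ) ^ ⌈1 / δ⌉₊ := by
        rw [← Real.rpow_natCast, ← Real.rpow_mul (by positivity)]
        refine Real.self_le_rpow_of_one_le hn1 ?_
        have h2 := mul_le_mul_of_nonneg_left (Nat.le_ceil (1 / δ)) hδ.le
        rwa [mul_one_div_cancel hδ.ne'] at h2
      have h2 : (1 : ℝ) < 2 ^ ⌈1 / δ⌉₊ :=
        one_lt_pow₀ one_lt_two (Nat.ceil_pos.2 (by positivity)).ne'
      rw [mul_pow]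
      nlinarith

/-- Of the `k + c + 2` multiples of `L` in the exponent, `k` pay for the families, `2` for the
number of draws, and `c` remain to give `m ^ (-c)`. -/
theorem error_bound {n m k c T s : ℕ} (hn : 1 ≤ n) (hm : 1 ≤ m) (hT : T ≤ Nat.log 2 n + 1) {q : ℝ}
    (hq : 0 < q) (hs : q * ((k + c + 2) * (1 + Real.log n + Real.log m)) ≤ s) :
    ((2 * T : ℕ) + 1) * ENNReal.ofReal ((m + 1) ^ k * Real.exp (-s / q)) ≤
      ((m : ℝ≥0∞) ^ c)⁻¹ := by
  have hn1 : (1 : ℝ) ≤ n := by exact_mod_cast hn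
  have hm1 : (1 : ℝ) ≤ m := by exact_mod_cast hm
  have hln : 0 ≤ Real.log n := Real.log_nonneg hn1
  have hlm : 0 ≤ Real.log m := Real.log_nonneg hm1
  have he : (2 : ℝ) ≤ Real.exp 1 := by linarith [Real.add_one_le_exp 1]
  set L := 1 + Real.log n + Real.log m with hL
  have hT' : ((2 * T : ℕ) : ℝ) + 1 ≤ Real.exp (2 * L) := by
    have h1 : T ≤ n := hT.trans (Nat.log_lt_self 2 (by omega))
    have h2 : (T : ℝ) ≤ n := by exact_mod_cast h1
    have h3 : (n : ℝ) * 2 ≤ Real.exp L := by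
      have h4 : Real.exp L = n * Real.exp 1 * m := by
        rw [hL, Real.exp_add, Real.exp_add, Real.exp_log (by linarith),
          Real.exp_log (by linarith)]
        ring
      rw [h4]
      nlinarith [mul_le_mul_of_nonneg_left he (by linarith : (0 : ℝ) ≤ n),
        mul_nonneg (by positivity : (0 : ℝ) ≤ n * Real.exp 1) (sub_nonneg.2 hm1)]
    have h5 : Real.exp (2 * L) = Real.exp L * Real.exp L := by rw [← Real.exp_add]; ring_nf
    push_cast
    rw [h5]
    nlinarith
  have hk : ((m : ℝ) + 1) ^ k ≤ Real.exp (k * L) := by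
    rw [Real.exp_nat_mul]
    refine pow_le_pow_left₀ (by positivity) ?_ k
    have h1 : Real.exp (1 + Real.log m) = Real.exp 1 * m := by
      rw [Real.exp_add, Real.exp_log (by linarith)]
    refine le_trans ?_ (Real.exp_le_exp.2 (by linarith : 1 + Real.log m ≤ L))
    rw [h1]
    nlinarith
  have hs' : Real.exp (-s / q) ≤ Real.exp (-((k + c + 2) * L)) := by
    refine Real.exp_le_exp.2 ?_
    rw [neg_div, neg_le_neg_iff, le_div_iff₀ hq]
    linarith
  have hc : Real.exp (-(c * L)) ≤ ((m : ℝ) ^ c)⁻¹ := by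
    rw [Real.exp_neg, Real.exp_nat_mul]
    refine inv_anti₀ (by positivity) (pow_le_pow_left₀ (by positivity) ?_ c)
    rw [← Real.exp_log (show (0 : ℝ) < m by linarith)]
    exact Real.exp_le_exp.2 (by linarith)
  have hcast : (((2 * T : ℕ) : ℝ≥0∞) + 1) = ENNReal.ofReal (((2 * T : ℕ) : ℝ) + 1) := by
    rw [ENNReal.ofReal_add (by positivity) zero_le_one, ENNReal.ofReal_natCast,
      ENNReal.ofReal_one]
  have hinv : ((m : ℝ≥0∞) ^ c)⁻¹ = ENNReal.ofReal ((m : ℝ) ^ c)⁻¹ := by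
    rw [ENNReal.ofReal_inv_of_pos (by positivity), ENNReal.ofReal_pow (by positivity),
      ENNReal.ofReal_natCast]
  rw [hcast, hinv, ← ENNReal.ofReal_mul (by positivity)]
  refine ENNReal.ofReal_le_ofReal (le_trans ?_ hc)
  calc _ ≤ Real.exp (2 * L) * (Real.exp (k * L) * Real.exp (-((k + c + 2) * L))) := by gcongr
    _ = _ := by
      rw [← Real.exp_add, ← Real.exp_add]
      ring_nf

/-- The dominant term `r s log m` is linear in `k` up to logarithms; one more factor `k` is given
away. Since `r ≥ 1`, the sample itself costs no more than the incidences. -/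
theorem space_bound {n m k r c T s : ℕ} (hn : 1 ≤ n) (hm : 1 ≤ m) (hk : 1 ≤ k) (hr : 1 ≤ r)
    (hT : T ≤ Nat.log 2 n + 1) {δ : ℝ} (hδ : 0 < δ)
    (hs : (s : ℝ) ≤ 2 * (n : ℝ) ^ δ * ((k + c + 2) * (1 + Real.log n + Real.log m)) + 1) :
    1 + n + (1 + k * (2 * T : ℕ) + k + r * s) * Real.logb 2 (m + 1) + s * Real.logb 2 n ≤
      (8 * c + 48) * ((r : ℝ) * (k : ℝ) ^ 2 * (n : ℝ) ^ δ + (n : ℝ)) *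
        (1 + Real.log n + Real.log m) ^ 2 := by
  have hn1 : (1 : ℝ) ≤ n := by exact_mod_cast hn
  have hm1 : (1 : ℝ) ≤ m := by exact_mod_cast hm
  have hk1 : (1 : ℝ) ≤ k := by exact_mod_cast hk
  have hr1 : (1 : ℝ) ≤ r := by exact_mod_cast hr
  have hln : 0 ≤ Real.log n := Real.log_nonneg hn1
  have hlm : 0 ≤ Real.log m := Real.log_nonneg hm1
  have hN : (1 : ℝ) ≤ (n : ℝ) ^ δ := Real.one_le_rpow hn1 hδ.le
  set L := 1 + Real.log n + Real.log m with hL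
  set N := (n : ℝ) ^ δ
  have hL1 : 1 ≤ L := by linarith
  have hlog2 : (1 : ℝ) / 2 ≤ Real.log 2 := by linarith [Real.log_two_gt_d9]
  have hlogb : ∀ x : ℝ, 0 ≤ x → x ≤ L → x / Real.log 2 ≤ 2 * L := fun x h0 hx => by
    rw [div_le_iff₀ (by linarith)]
    nlinarith
  have hbm : Real.logb 2 (m + 1) ≤ 2 * L := by
    refine hlogb _ (Real.log_nonneg (by linarith)) ?_
    have h1 : Real.log (m + 1) ≤ Real.log (2 * m) := Real.log_le_log (by linarith) (by linarith)
    rw [Real.log_mul (by norm_num) (by linarith)] at h1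
    linarith [Real.log_two_lt_d9]
  have hbn : Real.logb 2 n ≤ 2 * L := hlogb _ hln (by linarith)
  have hT' : ((2 * T : ℕ) : ℝ) ≤ 6 * L := by
    have h1 : (T : ℝ) ≤ Nat.log 2 n + 1 := by exact_mod_cast hT
    have h2 : (Nat.log 2 n : ℝ) ≤ Real.logb 2 n := Real.natLog_le_logb n 2
    push_cast
    linarith
  have hs' : (s : ℝ) ≤ k * N * L * (2 * c + 7) := by
    have h1 : (k : ℝ) + c + 2 ≤ k * (c + 3) := by
      nlinarith [mul_nonneg (sub_nonneg.2 hk1) (Nat.cast_nonneg (α := ℝ) c)]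
    have h2 : 1 ≤ k * N * L := one_le_mul_of_one_le_of_one_le
      (one_le_mul_of_one_le_of_one_le hk1 hN) hL1
    calc (s : ℝ) ≤ 2 * N * ((k + c + 2) * L) + 1 := hs
      _ ≤ 2 * N * (k * (c + 3) * L) + k * N * L := by gcongr
      _ = _ := by ring
  have hrs : r * (s : ℝ) ≤ (r * k ^ 2 * N) * L * (2 * c + 7) := by
    calc r * (s : ℝ) ≤ r * (k * N * L * (2 * c + 7)) := by gcongr
      _ ≤ r * (k ^ 2 * N * L * (2 * c + 7)) := by
        gcongr
        exact le_self_pow₀ hk1 two_ne_zero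
      _ = _ := by ring
  have hsr : (s : ℝ) ≤ r * s := le_mul_of_one_le_left (by positivity) hr1
  have hkX : (k : ℝ) ≤ r * k ^ 2 * N := by
    calc (k : ℝ) = 1 * k * 1 := by ring
      _ ≤ r * k ^ 2 * N := by
        gcongr
        exact le_self_pow₀ hk1 two_ne_zero
  set X := (r : ℝ) * k ^ 2 * N
  have hX1 : 1 ≤ X := hk1.trans hkX
  have hA : 1 + (k : ℝ) * (2 * T : ℕ) + k + r * s ≤ X * L * (2 * c + 15) := by
    have h1 : (k : ℝ) * (2 * T : ℕ) ≤ X * (6 * L) := by gcongr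
    have h2 : X ≤ X * L := le_mul_of_one_le_right (by linarith) hL1
    linarith
  have hXL : X ≤ X * L ^ 2 := le_mul_of_one_le_right (by linarith) (one_le_pow₀ hL1)
  have hnL : (n : ℝ) ≤ n * L ^ 2 := le_mul_of_one_le_right (by linarith) (one_le_pow₀ hL1)
  calc _ ≤ 1 + (n : ℝ) + (X * L * (2 * c + 15)) * (2 * L) + (X * L * (2 * c + 7)) * (2 * L) := by
        gcongr
        · exact Real.logb_nonneg one_lt_two (by linarith)
        · exact Real.logb_nonneg one_lt_two hn1
        · exact hsr.trans hrs
    _ = 1 + (n : ℝ) + (8 * c + 44) * (X * L ^ 2) := by ring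
    _ ≤ (8 * c + 48) * (X * L ^ 2) + (8 * c + 48) * (n * L ^ 2) := by
        have hc : (0 : ℝ) ≤ c := Nat.cast_nonneg c
        nlinarith [mul_nonneg hc (by linarith : 0 ≤ (n : ℝ) * L ^ 2)]
    _ = _ := by ring

/-- For `r = 0` the space bound has no `n^δ` term left to pay for a sample, but then no set contains
anything and `none` is always correct. -/
theorem exists_streamingAlgorithm_of_multiplicity_zero {n : ℕ} (m k : ℕ) (hn : 1 ≤ n) (β : ℝ) :
    ∃ A : StreamingAlgorithm n m, A.passes = 0 ∧ A.space = 0 ∧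
      ∀ S : Fin m → Finset (Fin n), (∀ x, elementMultiplicity S x ≤ 0) →
        (A.outputDist S).toOuterMeasure {o | ¬ IsCorrectAnswer S k β o} = 0 := by
  refine ⟨{ State := Unit, passes := 0, init := PMF.pure (), step := fun _ _ => PMF.pure (),
            endPass := fun _ => PMF.pure (), output := fun _ => none }, rfl, ?_, fun S hS => ?_⟩
  · simp [StreamingAlgorithm.space]
  · have hnone : IsCorrectAnswer S k β none := by
      rintro ⟨I, hI, -⟩
      obtain ⟨i, -, hi⟩ := hI ⟨0, hn⟩
      have h0 := Finset.card_eq_zero.1 (Nat.le_zero.1 (hS ⟨0, hn⟩))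
      exact Finset.notMem_empty i (h0 ▸ Finset.mem_filter.2 ⟨Finset.mem_univ i, hi⟩)
    rw [StreamingAlgorithm.outputDist, PMF.toOuterMeasure_map_apply]
    convert MeasureTheory.measure_empty (μ := PMF.toOuterMeasure _)
    ext x
    simpa using hnone

theorem mainTheorem10 :
    ∃ (C : ℝ) (p : ℕ), 0 < C ∧ ∀ c : ℕ, ∃ K : ℝ, 0 < K ∧
      ∀ δ : ℝ, 0 < δ → δ < 1 →
      ∀ n m k r : ℕ, 1 ≤ n → 1 ≤ k → k ≤ m →
      ∃ A : StreamingAlgorithm n m,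
        (A.passes : ℝ) ≤ C / δ ∧
        A.space ≤ K * ((r : ℝ) * (k : ℝ) ^ 2 * (n : ℝ) ^ δ + (n : ℝ)) *
          (1 + Real.log n + Real.log m) ^ p ∧
        ∀ S : Fin m → Finset (Fin n), (∀ x, elementMultiplicity S x ≤ r) →
          (A.outputDist S).toOuterMeasure {o | ¬ IsCorrectAnswer S k (C * k / δ) o} ≤
            ((m : ℝ≥0∞) ^ c)⁻¹ := by
  refine ⟨4, 2, by norm_num, fun c => ⟨8 * c + 48, by positivity, ?_⟩⟩
  intro δ hδ hδ1 n m k r hn hk hkm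
  rcases Nat.eq_zero_or_pos r with rfl | hr
  · obtain ⟨A, hA1, hA2, hA3⟩ :=
      exists_streamingAlgorithm_of_multiplicity_zero m k hn (4 * k / δ)
    refine ⟨A, ?_, ?_, fun S hS => (hA3 S hS).trans_le zero_le⟩
    · rw [hA1, Nat.cast_zero]
      positivity
    · rw [hA2]
      positivity
  · have hm : 1 ≤ m := hk.trans hkm
    obtain ⟨T, hT1, hT2, hT3⟩ := exists_number_of_rounds hn hδ hδ1
    have hq : 0 < 2 * (n : ℝ) ^ δ := by
      have : (0 : ℝ) < n := by exact_mod_cast hn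
      positivity
    have hT4 : ((2 * T : ℕ) : ℝ) ≤ 4 / δ := by
      have : 4 / δ = 2 * (2 / δ) := by ring
      push_cast
      linarith
    -- The sample size, rounded up below, is `q` times the exponent that `error_bound` requires.
    let a : ℝ := 2 * (n : ℝ) ^ δ * ((k + c + 2) * (1 + Real.log n + Real.log m))
    have ha : 0 ≤ a := by positivity
    choose ν hν using exists_sampler hn m k ⌈a⌉₊ hq
    refine ⟨samplingAlgorithm n m k r ⌈a⌉₊ (2 * T) ν, hT4, ?_, fun S hS => ?_⟩
    · exact (samplingAlgorithm_space hn).trans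
        (space_bound hn hm hk hr hT2 hδ (Nat.ceil_lt_add_one ha).le)
    · refine (samplingAlgorithm_error hS hq.le (fun U => hν U S) ?_ ?_).trans
        (error_bound hn hm hT2 hq (Nat.le_ceil a))
      · rwa [show (2 * T + 1) / 2 = T by omega]
      · have h1 : (4 : ℝ) * k / δ = k * (4 / δ) := by ring
        rw [h1, Nat.cast_mul]
        gcongr
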